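/- **Model.** A wireless network has a finite nonempty node set $V$, $N=|V|$. Time is slotted. In each slot one node, uniform on $V$, captures the channel and broadcasts; when $v$ broadcasts, node $u$ receives the packet with probability $P_{vu}$ (receptions at different nodes may be dependent; different slots are independent). Let $\mathbb F=\mathbb F_{2^q}$, $q\ge 1$, and let $(\mathbf x_u)_{u\in V}$ be linearly independent packets in $\mathbb F^r$. Let $S_u(t)$ be the set of messages held by $u$ at time $t$, with $S_u(0)=\{\mathbf x_u\}$. In each slot the transmitter $v$ broadcasts $\sum_{\mathbf m\in S_v(t)}\beta_{\mathbf m}\mathbf m$, with fresh coefficients $\beta_{\mathbf m}$ independent and uniform in $\mathbb F$, and every receiver adds this message to its set. The stopping time is $\mathcal T=\min\{t:\dim\operatorname{span}S_u(t)=N\ \forall u\in V\}$ ($\infty$ if there is no such $t$). Put $V_u=\{v\in V: P_{uv}>0\}$. The network is *connected* if for all $u,v\in V$ there is a directed path from $u$ to $v$ along links $(a,b)$ with $P_{ab}>0$. It is *sparsely connected at level $\varepsilon$* if it is connected and $|V_u|/|V|\le\varepsilon$ for all $u\in V$. **Statement.** There is an absolute constant $C>0$ such that the following holds for every such network, all $q,r$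 and all packets, and every $p>0$ such that $P_{uv}\ge p$ whenever $u\ne v$ and $P_{uv}>0$. 1. If the network is sparsely connected at some level $\varepsilon$, then $\mathbb E[\mathcal T]\le \frac{C}{p}N^2$. The constant does not depend on $\varepsilon$; thus $\mathbb E[\mathcal T]=O(N^2)$ for sparsely connected networks whose positive reception probabilities are bounded away from $0$. 2. If the network is connected and $N\ge 2$, then $N\le\mathbb E[\mathcal T]\le \frac{C}{p}N^2$, so the mean dissemination latency always lies between order $N$ and order $N^2$, whatever the topology. -/

import Mathlib

open MeasureTheory
open scoped ENNReal

/-- A slotted wireless network with node set `V`. When `v` broadcasts, the (random) set of nodes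
that receive the packet correctly has law `reception v`. Receptions at different nodes may be
independent or arbitrarily correlated. -/
structure WirelessNetwork (V : Type) where
  reception : V → PMF (Finset V)

namespace WirelessNetwork

variable {V : Type} (G : WirelessNetwork V)

/-- The reception probability `P_{vu}`: the probability that `u` receives a broadcast of `v`. -/
noncomputable def P (v u : V) : ℝ :=
  ((G.reception v).toOuterMeasure {R | u ∈ R}).toReal

/-- The transmission range `V_u = {v | P_{uv} > 0}` of the node `u`. -/
def range (u : V) : Set V := {v | 0 < G.P u v}

/-- The network is connected: every node can be reached from every node along links
of positive reception probability. -/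
def Connected : Prop :=
  ∀ u v : V, Relation.ReflTransGen (fun a b => 0 < G.P a b) u v

/-- The network is connected and each transmission range contains at most the fraction `ε` of
all the nodes. -/
def SparselyConnected (ε : ℝ) : Prop :=
  G.Connected ∧ ∀ u : V, ((G.range u).ncard : ℝ) / (Nat.card V : ℝ) ≤ ε

end WirelessNetwork

/-- What happens in one time slot: the node that captures the channel, the set of nodes that
receive its broadcast, and the random coefficients of the linear combination it forms (one for each
vector `m : M`; only those of messages which the transmitter holds are used). -/
structure Slot (V M F : Type) where
  transmitter : V
  receivers : Finset V
  coeff : M → F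

instance (V M F : Type) : MeasurableSpace (Slot V M F) := ⊤

namespace WirelessNetwork

variable {V : Type} (G : WirelessNetwork V)

/-- The law of one slot: the transmitter `v` is uniform on `V`, the receivers have law
`G.reception v`, and the coding coefficients are independent of both, and independent and uniform
in `F`. -/
noncomputable def slotLaw (M F : Type) [Fintype V] [Nonempty V]
    [Fintype M] [DecidableEq M] [Fintype F] [Nonempty F] : PMF (Slot V M F) :=
  (PMF.uniformOfFintype V).bind fun v =>
    (G.reception v).bind fun R =>
      (PMF.uniformOfFintype (M → F)).map fun c => ⟨v, R, c⟩

end WirelessNetwork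

section Dissemination

variable {V F : Type} {r : ℕ} [DecidableEq V] [Field F] [DecidableEq F]

/-- The set `S_u(t)` of messages held by node `u` at time `t`, for information packets `x` and a
realization `ω` of the slots. At time `0` node `u` holds only `x u`; in slot `t` the transmitter
broadcasts a random linear combination of the messages it holds, and each receiver stores it. -/
def messages (x : V → Fin r → F) (ω : ℕ → Slot V (Fin r → F) F) : ℕ → V → Finset (Fin r → F)
  | 0, u => {x u}
  | t + 1, u =>
    if u ∈ (ω t).receivers then
      insert (∑ m ∈ messages x ω t (ω t).transmitter, (ω t).coeff m • m) (messages x ω t u)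
    else messages x ω t u

/-- The stopping time: the first `t` at which the messages of every node span a space of
dimension `N = |V|`, and `⊤` if there is no such `t`. -/
noncomputable def stoppingTime (x : V → Fin r → F) (ω : ℕ → Slot V (Fin r → F) F) : ℕ∞ :=
  ⨅ t ∈ {t : ℕ | ∀ u : V,
    Module.finrank F (Submodule.span F (messages x ω t u : Set (Fin r → F))) = Nat.card V}, (t : ℕ∞)

/-- The expected stopping time in `[0, ∞]`, the slots being independent with law `G.slotLaw`. -/
noncomputable def WirelessNetwork.expectedStoppingTime [Fintype V] [Nonempty V] [Fintype F]
    (G : WirelessNetwork V) (x : V → Fin r → F) : ℝ≥0∞ :=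
  ∫⁻ ω, (stoppingTime x ω : ℝ≥0∞)
    ∂(Measure.infinitePi fun _ : ℕ => (G.slotLaw (Fin r → F) F).toMeasure)

end Dissemination

/-! Lower bound: the ranks of the nodes sum to at most N at time 0 and must reach N². One slot adds
at most N - 1, since the transmitter learns nothing from its own packet. Hence N slots are needed
(`card_le_of_complete`).

Upper bound: around each node w take the nested layers of nodes that reach w in at most d links, and
let g_d be the rank missing from layer d. By connectivity layer N is all of V, so g_N = 0. If g_d >
g_(d+1), some node just outside layer d holds a message outside that layer's span and has a link
into the layer. With probability at least (1/N)(p/2) the next slot lowers g_d.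

The potential sums 2^d · 2^(g_d) over all w and all d < N with g_d > 0. A drop of g_d at least
halves its term (`two_mul_deficitWeight_le`). In a run of constant g the factors 2^d make the last
index outweigh the earlier ones, and that index borders a drop, so improvable layers carry at least
half of the potential (`sum_deficitWeight_le`). The mean potential therefore shrinks by the factor 1
- p/(8N) per slot (`lintegral_potential_slotStep_add_le`). It starts at no more than 8^N and is at
least 1 while some node is incomplete, so P(T > t) ≤ (1 - p/(8N))^t 8^N. Summing over t gives
40N²/p. -/

/-! ### Rank growth along a fixed realization. -/

section Deterministic

variable {V F : Type} {r : ℕ} [Field F]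

/-- The packet that is broadcast in the slot `σ` when the nodes hold the messages `s`. -/
def broadcastPacket (s : V → Finset (Fin r → F)) (σ : Slot V (Fin r → F) F) : Fin r → F :=
  ∑ m ∈ s σ.transmitter, σ.coeff m • m

/-- The span of the messages held by the nodes in `A`. -/
def spanOn (s : V → Finset (Fin r → F)) (A : Set V) : Submodule F (Fin r → F) :=
  ⨆ u ∈ A, Submodule.span F (s u : Set (Fin r → F))

theorem span_le_spanOn (s : V → Finset (Fin r → F)) {A : Set V} {u : V} (hu : u ∈ A) :
    Submodule.span F (s u : Set (Fin r → F)) ≤ spanOn s A :=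
  le_iSup₂_of_le u hu le_rfl

theorem broadcastPacket_mem_span (s : V → Finset (Fin r → F)) (σ : Slot V (Fin r → F) F) :
    broadcastPacket s σ ∈ Submodule.span F (s σ.transmitter : Set (Fin r → F)) :=
  Submodule.sum_mem _ fun _ hm => Submodule.smul_mem _ _ (Submodule.subset_span hm)

variable [DecidableEq V] [DecidableEq F]

/-- The messages held after the slot `σ` by nodes that held the messages `s` before it. -/
def slotStep (s : V → Finset (Fin r → F)) (σ : Slot V (Fin r → F) F) :
    V → Finset (Fin r → F) := fun u =>
  if u ∈ σ.receivers then insert (broadcastPacket s σ) (s u) else s u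

theorem messages_succ (x : V → Fin r → F) (ω : ℕ → Slot V (Fin r → F) F) (t : ℕ) :
    messages x ω (t + 1) = slotStep (messages x ω t) (ω t) := rfl

theorem subset_slotStep (s : V → Finset (Fin r → F)) (σ : Slot V (Fin r → F) F) (u : V) :
    s u ⊆ slotStep s σ u := by
  unfold slotStep
  split_ifs
  · exact Finset.subset_insert _ _
  · exact subset_rfl

theorem spanOn_le_slotStep (s : V → Finset (Fin r → F)) (σ : Slot V (Fin r → F) F)
    (A : Set V) : spanOn s A ≤ spanOn (slotStep s σ) A :=
  iSup₂_mono fun u _ => Submodule.span_mono (by exact_mod_cast subset_slotStep s σ u)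

theorem broadcastPacket_mem_spanOn_slotStep (s : V → Finset (Fin r → F))
    (σ : Slot V (Fin r → F) F) {A : Set V} {b : V} (hb : b ∈ A) (hr : b ∈ σ.receivers) :
    broadcastPacket s σ ∈ spanOn (slotStep s σ) A := by
  refine span_le_spanOn _ hb (Submodule.subset_span ?_)
  simp [slotStep, hr]

theorem finrank_spanOn_lt_slotStep (s : V → Finset (Fin r → F))
    (σ : Slot V (Fin r → F) F) {A : Set V} {b : V} (hb : b ∈ A) (hr : b ∈ σ.receivers)
    (hn : broadcastPacket s σ ∉ spanOn s A) :
    Module.finrank F (spanOn s A) < Module.finrank F (spanOn (slotStep s σ) A) :=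
  Submodule.finrank_lt_finrank_of_lt <| lt_of_le_of_ne (spanOn_le_slotStep s σ A) fun h =>
    hn (h ▸ broadcastPacket_mem_spanOn_slotStep s σ hb hr)

theorem packet_mem_messages (x : V → Fin r → F) (ω : ℕ → Slot V (Fin r → F) F) (t : ℕ) (u : V) :
    x u ∈ messages x ω t u := by
  induction t with
  | zero => simp [messages]
  | succ t ih => rw [messages_succ]; exact subset_slotStep _ _ _ ih

theorem span_messages_le (x : V → Fin r → F) (ω : ℕ → Slot V (Fin r → F) F) (t : ℕ) (u : V) :
    Submodule.span F (messages x ω t u : Set (Fin r → F)) ≤ Submodule.span F (Set.range x) := by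
  induction t generalizing u with
  | zero =>
    refine Submodule.span_mono ?_
    simp [messages]
  | succ t ih =>
    rw [messages_succ, Submodule.span_le]
    intro m hm
    unfold slotStep at hm
    split_ifs at hm
    · rcases Finset.mem_insert.1 (Finset.mem_coe.1 hm) with rfl | h
      · exact ih _ (broadcastPacket_mem_span _ _)
      · exact ih u (Submodule.subset_span h)
    · exact ih u (Submodule.subset_span hm)

/-- One slot raises the rank of every node by at most one, and not that of the transmitter. -/
theorem finrank_span_slotStep_le (s : V → Finset (Fin r → F)) (σ : Slot V (Fin r → F) F) (u : V) :
    Module.finrank F (Submodule.span F (slotStep s σ u : Set (Fin r → F))) ≤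
      Module.finrank F (Submodule.span F (s u : Set (Fin r → F))) +
        if u = σ.transmitter then 0 else 1 := by
  unfold slotStep
  by_cases h1 : u ∈ σ.receivers
  swap
  · rw [if_neg h1]
    exact Nat.le_add_right _ _
  rw [if_pos h1]
  split_ifs with h2
  · subst h2
    rw [Finset.coe_insert, Submodule.span_insert_eq_span (broadcastPacket_mem_span s σ), add_zero]
  · rw [Finset.coe_insert, Submodule.span_insert]
    refine (Submodule.finrank_add_le_finrank_add_finrank _ _).trans ?_
    rw [add_comm]
    gcongr
    exact (finrank_span_le_card {broadcastPacket s σ}).trans (by simp)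

theorem sum_finrank_messages_le [Fintype V] (x : V → Fin r → F) (ω : ℕ → Slot V (Fin r → F) F)
    (t : ℕ) :
    ∑ u, Module.finrank F (Submodule.span F (messages x ω t u : Set (Fin r → F))) ≤
      Fintype.card V + t * (Fintype.card V - 1) := by
  induction t with
  | zero =>
    rw [zero_mul, add_zero]
    calc _ ≤ ∑ _u : V, 1 := Finset.sum_le_sum fun u _ => (finrank_span_finset_le_card (R := F) _).trans (by simp [messages])
      _ = _ := by simp
  | succ t ih =>
    rw [messages_succ]
    refine (Finset.sum_le_sum fun u _ => finrank_span_slotStep_le _ _ u).trans ?_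
    rw [Finset.sum_add_distrib]
    have h : ∑ u, (if u = (ω t).transmitter then 0 else 1) = Fintype.card V - 1 := by
      rw [Finset.sum_ite]
      simp [Finset.filter_ne', Finset.card_erase_of_mem]
    rw [h, add_mul, one_mul]
    omega

/-- Completion forces N² ≤ N + t(N - 1), and N - 1 can be cancelled because N ≥ 2. -/
theorem card_le_of_complete [Fintype V] (hN : 2 ≤ Fintype.card V) (x : V → Fin r → F)
    (ω : ℕ → Slot V (Fin r → F) F) (t : ℕ)
    (h : ∀ u, Module.finrank F (Submodule.span F (messages x ω t u : Set (Fin r → F))) =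
      Nat.card V) : Fintype.card V ≤ t := by
  have h1 := sum_finrank_messages_le x ω t
  simp only [h, Nat.card_eq_fintype_card, Finset.sum_const, Finset.card_univ, smul_eq_mul] at h1
  obtain ⟨k, hk⟩ := Nat.exists_eq_add_of_le' hN
  rw [hk] at h1 ⊢
  have : k + 2 - 1 = k + 1 := rfl
  rw [this] at h1
  by_contra! hc
  nlinarith

theorem card_le_stoppingTime [Fintype V] (hN : 2 ≤ Fintype.card V) (x : V → Fin r → F)
    (ω : ℕ → Slot V (Fin r → F) F) : (Fintype.card V : ℕ∞) ≤ stoppingTime x ω :=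
  le_iInf₂ fun t ht => by exact_mod_cast card_le_of_complete hN x ω t ht

/-- Every slot before the first completion contributes 1 to the series. Only this inequality is
needed, so persistence of completion plays no role. -/
theorem stoppingTime_le_tsum (x : V → Fin r → F) (ω : ℕ → Slot V (Fin r → F) F) :
    (stoppingTime x ω : ℝ≥0∞) ≤ ∑' t : ℕ, {ω | ¬ ∀ u : V,
      Module.finrank F (Submodule.span F (messages x ω t u : Set (Fin r → F))) =
        Nat.card V}.indicator 1 ω := by
  classical
  by_cases h : ∃ t : ℕ, ∀ u : V,
    Module.finrank F (Submodule.span F (messages x ω t u : Set (Fin r → F))) = Nat.card V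
  · have h1 : stoppingTime x ω ≤ (Nat.find h : ℕ∞) := iInf₂_le _ (Nat.find_spec h)
    calc (stoppingTime x ω : ℝ≥0∞) ≤ ((Nat.find h : ℕ∞) : ℝ≥0∞) := by exact_mod_cast h1
      _ = ∑ _t ∈ Finset.range (Nat.find h), (1 : ℝ≥0∞) := by simp
      _ ≤ ∑ t ∈ Finset.range (Nat.find h), {ω | ¬ ∀ u : V,
            Module.finrank F (Submodule.span F (messages x ω t u : Set (Fin r → F))) =
              Nat.card V}.indicator 1 ω := by
          refine Finset.sum_le_sum fun t ht => ?_
          rw [Set.indicator_of_mem]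
          · rfl
          · exact Nat.find_min h (Finset.mem_range.1 ht)
      _ ≤ _ := ENNReal.sum_le_tsum _
  · have : ∀ t : ℕ, {ω | ¬ ∀ u : V,
      Module.finrank F (Submodule.span F (messages x ω t u : Set (Fin r → F))) =
        Nat.card V}.indicator (1 : (ℕ → Slot V (Fin r → F) F) → ℝ≥0∞) ω = 1 := fun t => by
      rw [Set.indicator_of_mem]
      · rfl
      · exact fun h' => h ⟨t, h'⟩
    simp only [this]
    rw [ENNReal.tsum_const_eq_top_of_ne_zero one_ne_zero]
    exact le_top

end Deterministic

/-! ### Layers of nodes by distance to a target. -/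

namespace WirelessNetwork

variable {V : Type} (G : WirelessNetwork V)

/-- The nodes from which `w` can be reached along at most `d` links. -/
def layer (w : V) : ℕ → Set V
  | 0 => {w}
  | d + 1 => layer w d ∪ {v | ∃ b ∈ layer w d, 0 < G.P v b}

theorem mem_layer (w : V) (d : ℕ) : w ∈ G.layer w d := by
  induction d with
  | zero => rfl
  | succ d ih => exact Or.inl ih

variable {G}

/-- A layer equal to the next one is closed under predecessors, so following a path back from w it
would contain every node. -/
theorem Connected.layer_ssubset (hG : G.Connected) {w : V} {d : ℕ}
    (h : G.layer w d ≠ Set.univ) : G.layer w d ⊂ G.layer w (d + 1) := by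
  refine LE.le.ssubset_of_ne Set.subset_union_left fun he => ?_
  obtain ⟨v, hv⟩ := (Set.ne_univ_iff_exists_notMem _).1 h
  refine hv ?_
  refine Relation.ReflTransGen.head_induction_on (hG v w) (G.mem_layer w d) ?_
  intro a c hac _ hc
  rw [he]
  exact Or.inr ⟨c, hc, hac⟩

theorem Connected.layer_eq_univ_or [Finite V] (hG : G.Connected) (w : V) (d : ℕ) :
    G.layer w d = Set.univ ∨ d + 1 ≤ (G.layer w d).ncard := by
  induction d with
  | zero => right; simp [layer]
  | succ d ih =>
    by_cases h : G.layer w d = Set.univ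
    · left
      rw [← Set.univ_subset_iff, ← h]
      exact Set.subset_union_left
    · right
      have h1 := ih.resolve_left h
      have h2 := Set.ncard_lt_ncard (hG.layer_ssubset h) (Set.toFinite _)
      omega

theorem Connected.layer_card [Finite V] (hG : G.Connected) (w : V) :
    G.layer w (Nat.card V) = Set.univ := by
  refine (hG.layer_eq_univ_or w _).resolve_right fun h => ?_
  have := Set.ncard_le_card (G.layer w (Nat.card V))
  omega

end WirelessNetwork

/-! ### Geometric weights for rank deficits. -/

/-- The potential of a rank deficit. -/
def deficitWeight (g : ℕ) : ℕ := if g = 0 then 0 else 2 ^ g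

theorem deficitWeight_mono : Monotone deficitWeight := by
  intro a b h
  unfold deficitWeight
  split_ifs with h1 h2
  · rfl
  · exact Nat.zero_le _
  · omega
  · exact Nat.pow_le_pow_right (by norm_num) h

/-- The weight doubles with each unit of deficit; the value 0 at deficit 0 keeps the halving valid
for the final drop. -/
theorem two_mul_deficitWeight_le {a b : ℕ} (h : a < b) :
    2 * deficitWeight a ≤ deficitWeight b := by
  unfold deficitWeight
  split_ifs with h1 h2
  · omega
  · simp
  · omega
  · calc 2 * 2 ^ a = 2 ^ (a + 1) := by ring
      _ ≤ 2 ^ b := Nat.pow_le_pow_right (by norm_num) h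

/-- The indices at which a sequence strictly drops carry, with geometric weights,
at least half of the total weight. -/
theorem sum_deficitWeight_le (g : ℕ → ℕ) (n : ℕ) :
    ∑ d ∈ Finset.range n, 2 ^ d * deficitWeight (g d) ≤
      2 * (∑ d ∈ Finset.range n, if g d = g (d + 1) then 0 else 2 ^ d * deficitWeight (g d)) +
        2 ^ n * deficitWeight (g n) := by
  induction n with
  | zero => simp
  | succ n ih =>
    rw [Finset.sum_range_succ, Finset.sum_range_succ, pow_succ]
    -- On a plateau the new term doubles the boundary term. At a change the old boundary term and
    -- the new term are equal, and twice the new term on the right pays for both.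
    split_ifs with h
    · rw [← h]
      nlinarith
    · nlinarith [Nat.zero_le (2 ^ n * 2 * deficitWeight (g (n + 1)))]

/-! ### Probability that a slot is innovative. -/

section SlotLaw

instance (V M F : Type) : DiscreteMeasurableSpace (Slot V M F) := ⟨fun _ => trivial⟩

instance (V M F : Type) [Finite V] [Finite M] [Finite F] : Finite (Slot V M F) := by
  refine Finite.of_injective
    (fun σ : Slot V M F => (σ.transmitter, σ.receivers, σ.coeff)) ?_
  rintro ⟨a, b, c⟩ ⟨a', b', c'⟩ h
  simp only [Prod.mk.injEq] at h
  obtain ⟨rfl, rfl, rfl⟩ := h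
  rfl

variable {V F : Type} {r : ℕ} [Field F] [Fintype F] [DecidableEq F]

/-- A uniform random combination of vectors that do not all lie in `W` avoids `W` with
probability at least one half. -/
theorem half_le_uniform_sum_notMem (S : Finset (Fin r → F)) (W : Submodule F (Fin r → F))
    (h : ∃ m ∈ S, m ∉ W) :
    (2 : ℝ≥0∞)⁻¹ ≤ (PMF.uniformOfFintype ((Fin r → F) → F)).toOuterMeasure
      {c | ∑ m ∈ S, c m • m ∉ W} := by
  classical
  obtain ⟨a, haS, haW⟩ := h
  set T : Set ((Fin r → F) → F) := {c | ∑ m ∈ S, c m • m ∉ W} with hT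
  have hle : Fintype.card ↥(Tᶜ) ≤ Fintype.card T := by
    -- Raising the coefficient of `a` by 1 adds `a ∉ W` to the sum, which injects the bad
    -- coefficient choices into the good ones.
    refine Fintype.card_le_of_injective
      (fun c => (⟨c.1 + Pi.single a 1, ?_⟩ : T)) ?_
    · have hc : ∑ m ∈ S, c.1 m • m ∈ W := not_not.1 c.2
      simp only [hT, Set.mem_ofPred_eq, Pi.add_apply, add_smul, Finset.sum_add_distrib]
      rw [Submodule.add_mem_iff_right _ hc]
      rw [Finset.sum_eq_single_of_mem a haS]
      · simpa using haW
      · intro b _ hb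
        simp [Pi.single_eq_of_ne hb]
    · intro c c' hcc
      simpa [Subtype.ext_iff] using hcc
  have hsum : Fintype.card ((Fin r → F) → F) ≤ 2 * Fintype.card T := by
    rw [Fintype.card_compl_set] at hle
    omega
  rw [PMF.toOuterMeasure_uniformOfFintype_apply, ENNReal.le_div_iff_mul_le (by simp) (by simp),
    mul_comm, ← div_eq_mul_inv]
  refine ENNReal.div_le_of_le_mul' ?_
  exact_mod_cast hsum

variable [Fintype V] [Nonempty V]

/-- The probability that the node `v` transmits, `b` receives, and the packet avoids `W`. -/
theorem le_slotLaw_transmit (G : WirelessNetwork V) (s : V → Finset (Fin r → F))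
    (W : Submodule F (Fin r → F)) {v b : V} (h : ∃ m ∈ s v, m ∉ W) {p : ℝ} (hp : p ≤ G.P v b) :
    (Fintype.card V : ℝ≥0∞)⁻¹ * (ENNReal.ofReal p * 2⁻¹) ≤
      (G.slotLaw (Fin r → F) F).toMeasure
        {σ | b ∈ σ.receivers ∧ broadcastPacket s σ ∉ W} := by
  classical
  have hP : ENNReal.ofReal p ≤ (G.reception v).toOuterMeasure {R | b ∈ R} :=
    ENNReal.ofReal_le_of_le_toReal hp
  rw [PMF.toMeasure_apply_eq_toOuterMeasure_apply _ (MeasurableSet.of_discrete),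
    WirelessNetwork.slotLaw, PMF.toOuterMeasure_bind_apply]
  refine le_trans ?_ (ENNReal.le_tsum v)
  rw [PMF.uniformOfFintype_apply]
  gcongr
  refine (mul_le_mul_left hP _).trans ?_
  rw [PMF.toOuterMeasure_bind_apply, PMF.toOuterMeasure_apply, ← ENNReal.tsum_mul_right]
  refine ENNReal.tsum_le_tsum fun R => ?_
  by_cases hR : b ∈ R
  · rw [Set.indicator_of_mem (by exact hR)]
    gcongr
    rw [PMF.toOuterMeasure_map_apply]
    simpa [broadcastPacket, Set.preimage, hR] using half_le_uniform_sum_notMem (s v) W h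
  · rw [Set.indicator_of_notMem (by exact hR), zero_mul]
    exact zero_le

end SlotLaw

/-! ### Drift of the potential in one slot. -/

section Drift

variable {V F : Type} {r : ℕ} [Field F] [Fintype V]

/-- How much the rank of the messages held in `A` falls short of the number of nodes. -/
noncomputable def rankDeficit (s : V → Finset (Fin r → F)) (A : Set V) : ℕ :=
  Fintype.card V - Module.finrank F (spanOn s A)

/-- The potential of the layer `d` around `w`. -/
noncomputable def layerPotential (G : WirelessNetwork V) (s : V → Finset (Fin r → F)) (w : V)
    (d : ℕ) : ℕ :=
  2 ^ d * deficitWeight (rankDeficit s (G.layer w d))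

/-- The total potential, summed over all layers around all nodes. -/
noncomputable def potential (G : WirelessNetwork V) (s : V → Finset (Fin r → F)) : ℕ :=
  ∑ w, ∑ d ∈ Finset.range (Fintype.card V), layerPotential G s w d

theorem rankDeficit_anti (s : V → Finset (Fin r → F)) {A B : Set V} (h : A ⊆ B) :
    rankDeficit s B ≤ rankDeficit s A :=
  Nat.sub_le_sub_left (Submodule.finrank_mono (biSup_mono h)) _

theorem rankDeficit_univ {s x : V → _} (hx : LinearIndependent F x)
    (hs : ∀ u, x u ∈ (s u : Finset (Fin r → F))) : rankDeficit s Set.univ = 0 := by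
  rw [rankDeficit, ← finrank_span_eq_card hx, Nat.sub_eq_zero_iff_le]
  refine Submodule.finrank_mono (Submodule.span_le.2 ?_)
  rintro _ ⟨u, rfl⟩
  exact span_le_spanOn s (Set.mem_univ u) (Submodule.subset_span (hs u))

theorem potential_le (G : WirelessNetwork V) (s : V → Finset (Fin r → F)) :
    potential G s ≤ 8 ^ Fintype.card V := by
  set N := Fintype.card V with hN
  have h1 : ∀ w d, layerPotential G s w d ≤ 2 ^ d * 2 ^ N := fun w d => by
    refine Nat.mul_le_mul_left _ ((deficitWeight_mono (Nat.sub_le _ _)).trans ?_)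
    rw [deficitWeight]
    split_ifs
    · exact Nat.zero_le _
    · rfl
  calc potential G s ≤ ∑ _w : V, ∑ d ∈ Finset.range N, 2 ^ d * 2 ^ N :=
        Finset.sum_le_sum fun w _ => Finset.sum_le_sum fun d _ => h1 w d
    _ = N * ((∑ d ∈ Finset.range N, 2 ^ d) * 2 ^ N) := by
        rw [← Finset.sum_mul]; simp [hN]
    _ ≤ 2 ^ N * (2 ^ N * 2 ^ N) := by
        gcongr
        · exact Nat.lt_two_pow_self.le
        · have := Nat.geomSum_lt (m := 2) (n := N) (s := Finset.range N) le_rfl (by simp)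
          exact this.le
    _ = 8 ^ N := by
        rw [← mul_pow, ← mul_pow]; norm_num

variable [DecidableEq V] [DecidableEq F]

theorem rankDeficit_slotStep_le (s : V → Finset (Fin r → F)) (σ : Slot V (Fin r → F) F)
    (A : Set V) : rankDeficit (slotStep s σ) A ≤ rankDeficit s A :=
  Nat.sub_le_sub_left (Submodule.finrank_mono (spanOn_le_slotStep s σ A)) _

theorem layerPotential_slotStep_le (G : WirelessNetwork V) (s : V → Finset (Fin r → F))
    (σ : Slot V (Fin r → F) F) (w : V) (d : ℕ) :
    layerPotential G (slotStep s σ) w d ≤ layerPotential G s w d :=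
  Nat.mul_le_mul_left _ (deficitWeight_mono (rankDeficit_slotStep_le s σ _))

variable [Fintype F] [Nonempty V]

theorem lintegral_layerPotential_slotStep_le (G : WirelessNetwork V)
    (s : V → Finset (Fin r → F)) (w : V) (d : ℕ) :
    ∫⁻ σ, (layerPotential G (slotStep s σ) w d : ℝ≥0∞)
      ∂(G.slotLaw (Fin r → F) F).toMeasure ≤ layerPotential G s w d := by
  calc _ ≤ ∫⁻ _, (layerPotential G s w d : ℝ≥0∞) ∂(G.slotLaw (Fin r → F) F).toMeasure :=
        lintegral_mono fun σ => Nat.cast_le.2 (layerPotential_slotStep_le G s σ w d)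
    _ = _ := by simp

/-- If the ranks of two consecutive layers differ, then the potential of the inner one
decreases in the mean. -/
theorem lintegral_layerPotential_slotStep_add_le (G : WirelessNetwork V)
    {p : ℝ} (hp : ∀ u v : V, u ≠ v → 0 < G.P u v → p ≤ G.P u v)
    (s : V → Finset (Fin r → F)) (w : V) (d : ℕ)
    (h : rankDeficit s (G.layer w d) ≠ rankDeficit s (G.layer w (d + 1))) :
    ∫⁻ σ, (layerPotential G (slotStep s σ) w d : ℝ≥0∞)
        ∂(G.slotLaw (Fin r → F) F).toMeasure +
      (Fintype.card V : ℝ≥0∞)⁻¹ * (ENNReal.ofReal p * 2⁻¹) * 2⁻¹ * layerPotential G s w d ≤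
      layerPotential G s w d := by
  have hlt := lt_of_le_of_ne
    (rankDeficit_anti s (A := G.layer w d) (B := G.layer w (d + 1)) Set.subset_union_left) h.symm
  -- Otherwise the outer layer would span no more than the inner one, and the deficits would agree.
  obtain ⟨v, hv, m, hm, hmW⟩ : ∃ v ∈ G.layer w (d + 1), ∃ m ∈ s v,
      m ∉ spanOn s (G.layer w d) := by
    by_contra! hc
    have : spanOn s (G.layer w (d + 1)) ≤ spanOn s (G.layer w d) :=
      iSup₂_le fun v hv => Submodule.span_le.2 fun m hm => hc v hv m hm
    exact absurd hlt (not_lt.2 (Nat.sub_le_sub_left (Submodule.finrank_mono this) _))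
  have hvd : v ∉ G.layer w d := fun hc => hmW (span_le_spanOn s hc (Submodule.subset_span hm))
  obtain ⟨b, hb, hvb⟩ := hv.resolve_left hvd
  have hne : v ≠ b := fun hc => hvd (hc ▸ hb)
  have hprob := le_slotLaw_transmit G s (spanOn s (G.layer w d)) ⟨m, hm, hmW⟩ (hp v b hne hvb)
  set E : Set (Slot V (Fin r → F) F) :=
    {σ | b ∈ σ.receivers ∧ broadcastPacket s σ ∉ spanOn s (G.layer w d)} with hE
  set φ := layerPotential G s w d with hφ
  have hpt : ∀ σ, (layerPotential G (slotStep s σ) w d : ℝ≥0∞) +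
      E.indicator (fun _ => 2⁻¹ * (φ : ℝ≥0∞)) σ ≤ φ := by
    intro σ
    by_cases hσ : σ ∈ E
    · have h1 := finrank_spanOn_lt_slotStep s σ hb hσ.1 hσ.2
      have h2 : rankDeficit (slotStep s σ) (G.layer w d) < rankDeficit s (G.layer w d) := by
        -- Subtraction is truncated: `hlt` makes the inner deficit positive, so a gain in rank does
        -- lower it.
        unfold rankDeficit at hlt ⊢
        omega
      have h3 : 2 * layerPotential G (slotStep s σ) w d ≤ φ := by
        have := Nat.mul_le_mul_left (2 ^ d) (two_mul_deficitWeight_le h2)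
        calc _ = 2 ^ d * (2 * deficitWeight (rankDeficit (slotStep s σ) (G.layer w d))) := by
              unfold layerPotential; ring
          _ ≤ φ := this
      rw [Set.indicator_of_mem hσ]
      have h4 : (layerPotential G (slotStep s σ) w d : ℝ≥0∞) ≤ 2⁻¹ * φ := by
        rw [mul_comm, ← div_eq_mul_inv, ENNReal.le_div_iff_mul_le (by simp) (by simp), mul_comm]
        exact_mod_cast h3
      calc _ ≤ 2⁻¹ * (φ : ℝ≥0∞) + 2⁻¹ * φ := by gcongr
        _ = φ := by rw [← add_mul, ENNReal.inv_two_add_inv_two, one_mul]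
    · rw [Set.indicator_of_notMem hσ, add_zero]
      exact_mod_cast layerPotential_slotStep_le G s σ w d
  calc _ ≤ ∫⁻ σ, (layerPotential G (slotStep s σ) w d : ℝ≥0∞)
        ∂(G.slotLaw (Fin r → F) F).toMeasure +
        ∫⁻ σ, E.indicator (fun _ => 2⁻¹ * (φ : ℝ≥0∞)) σ
          ∂(G.slotLaw (Fin r → F) F).toMeasure := by
        gcongr
        rw [lintegral_indicator_const .of_discrete, mul_assoc, mul_comm]
        gcongr
    _ = ∫⁻ σ, ((layerPotential G (slotStep s σ) w d : ℝ≥0∞) +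
          E.indicator (fun _ => 2⁻¹ * (φ : ℝ≥0∞)) σ)
          ∂(G.slotLaw (Fin r → F) F).toMeasure :=
        (lintegral_add_left .of_discrete _).symm
    _ ≤ ∫⁻ _, (φ : ℝ≥0∞) ∂(G.slotLaw (Fin r → F) F).toMeasure := lintegral_mono hpt
    _ = φ := by simp

/-- The total potential decreases in the mean by a constant fraction. -/
theorem lintegral_potential_slotStep_add_le {G : WirelessNetwork V} (hG : G.Connected)
    {p : ℝ} (hp : ∀ u v : V, u ≠ v → 0 < G.P u v → p ≤ G.P u v)
    {s x : V → _} (hx : LinearIndependent F x)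
    (hs : ∀ u, x u ∈ (s u : Finset (Fin r → F))) :
    ∫⁻ σ, (potential G (slotStep s σ) : ℝ≥0∞) ∂(G.slotLaw (Fin r → F) F).toMeasure +
      (Fintype.card V : ℝ≥0∞)⁻¹ * (ENNReal.ofReal p * 8⁻¹) * potential G s ≤ potential G s := by
  set N := Fintype.card V with hN
  -- The loss rate of one improvable layer: choice of transmitter, reception with an innovative
  -- packet, halving. The further factor 2 from `sum_deficitWeight_le` turns 1/4 into 1/8.
  set a : ℝ≥0∞ := (N : ℝ≥0∞)⁻¹ * (ENNReal.ofReal p * 2⁻¹) * 2⁻¹ with ha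
  have hκ : (N : ℝ≥0∞)⁻¹ * (ENNReal.ofReal p * 8⁻¹) * 2 = a := by
    have : (8 : ℝ≥0∞)⁻¹ * 2 = 2⁻¹ * 2⁻¹ := by
      rw [show (8 : ℝ≥0∞) = 2 * 2 * 2 by norm_num, ENNReal.mul_inv (by simp) (by simp),
        ENNReal.mul_inv (by simp) (by simp), mul_assoc, ENNReal.inv_mul_cancel (by simp) (by simp),
        mul_one]
    rw [ha, mul_assoc, mul_assoc, this]
    ring
  unfold potential
  simp only [Nat.cast_sum]
  rw [lintegral_finsetSum _ fun _ _ => .of_discrete, Finset.mul_sum, ← Finset.sum_add_distrib]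
  refine Finset.sum_le_sum fun w _ => ?_
  rw [lintegral_finsetSum _ fun _ _ => .of_discrete]
  have hsum := sum_deficitWeight_le (fun d => rankDeficit s (G.layer w d)) N
  have hlast : rankDeficit s (G.layer w N) = 0 := by
    rw [hN, ← Nat.card_eq_fintype_card, hG.layer_card w]
    exact rankDeficit_univ hx hs
  rw [hlast, deficitWeight, if_pos rfl, mul_zero, add_zero] at hsum
  set act : ℕ → ℕ := fun d =>
    if rankDeficit s (G.layer w d) = rankDeficit s (G.layer w (d + 1)) then 0
    else layerPotential G s w d with hact
  have hsum' : ∑ d ∈ Finset.range N, (layerPotential G s w d : ℝ≥0∞) ≤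
      2 * ∑ d ∈ Finset.range N, (act d : ℝ≥0∞) := by
    exact_mod_cast hsum
  calc _ ≤ ∑ d ∈ Finset.range N, ∫⁻ σ, (layerPotential G (slotStep s σ) w d : ℝ≥0∞)
          ∂(G.slotLaw (Fin r → F) F).toMeasure +
        (N : ℝ≥0∞)⁻¹ * (ENNReal.ofReal p * 8⁻¹) *
          (2 * ∑ d ∈ Finset.range N, (act d : ℝ≥0∞)) := by gcongr
    _ = ∑ d ∈ Finset.range N, (∫⁻ σ, (layerPotential G (slotStep s σ) w d : ℝ≥0∞)
          ∂(G.slotLaw (Fin r → F) F).toMeasure + a * act d) := by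
        rw [← mul_assoc, hκ, Finset.mul_sum, Finset.sum_add_distrib]
    _ ≤ _ := by
        refine Finset.sum_le_sum fun d _ => ?_
        simp only [hact]
        split_ifs with h
        · simpa using lintegral_layerPotential_slotStep_le G s w d
        · exact lintegral_layerPotential_slotStep_add_le G hp s w d h

end Drift

/-! ### Summing the tail probabilities. -/

/-- Since 8 ≤ e³, the geometric factor has absorbed 8^N by time T = ⌈3N/κ⌉. The head costs at most T
< 3N/κ + 1 and the tail at most 1/κ; both 1 and 1/κ are at most N/κ. -/
theorem tsum_le_of_le_one_of_le_geometric {f : ℕ → ℝ≥0∞} {κ : ℝ} (h0 : 0 < κ) (h1 : κ ≤ 1)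
    {N : ℕ} (hN : 1 ≤ N) (hf1 : ∀ t, f t ≤ 1)
    (hf : ∀ t, f t ≤ (1 - ENNReal.ofReal κ) ^ t * 8 ^ N) :
    ∑' t, f t ≤ ENNReal.ofReal (5 * N / κ) := by
  have hN' : (1 : ℝ) ≤ N := by exact_mod_cast hN
  have hsub : 1 - ENNReal.ofReal κ = ENNReal.ofReal (1 - κ) := by
    rw [ENNReal.ofReal_sub _ h0.le, ENNReal.ofReal_one]
  set T := ⌈3 * N / κ⌉₊ with hT
  have hTle : (3 * N / κ : ℝ) ≤ T := Nat.le_ceil _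
  have hTlt : (T : ℝ) < 3 * N / κ + 1 := Nat.ceil_lt_add_one (by positivity)
  have hκT : 3 * N ≤ κ * T := by
    rw [div_le_iff₀ h0] at hTle
    linarith
  have hsmall : (1 - ENNReal.ofReal κ) ^ T * 8 ^ N ≤ 1 := by
    have h8 : (8 : ℝ) ≤ Real.exp 3 := by
      have := Real.exp_one_gt_d9
      rw [show (3 : ℝ) = (3 : ℕ) * 1 by norm_num, Real.exp_nat_mul]
      calc (8 : ℝ) = 2 ^ 3 := by norm_num
        _ ≤ _ := pow_le_pow_left₀ (by norm_num) (by linarith) 3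
    have hreal : (1 - κ) ^ T * 8 ^ N ≤ 1 := by
      calc (1 - κ) ^ T * 8 ^ N ≤ Real.exp (-κ) ^ T * Real.exp 3 ^ N := by
            have := Real.one_sub_le_exp_neg κ
            gcongr
        _ = Real.exp (3 * N - κ * T) := by
            rw [← Real.exp_nat_mul, ← Real.exp_nat_mul, ← Real.exp_add]
            congr 1
            ring
        _ ≤ 1 := Real.exp_le_one_iff.2 (by linarith)
    have := ENNReal.ofReal_le_ofReal hreal
    rwa [ENNReal.ofReal_mul (pow_nonneg (by linarith) _), ENNReal.ofReal_pow (by linarith), ← hsub,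
      ENNReal.ofReal_pow (by norm_num), ENNReal.ofReal_one, ENNReal.ofReal_ofNat] at this
  have htail : ∑' t, f (t + T) ≤ ENNReal.ofReal κ⁻¹ := by
    calc ∑' t, f (t + T) ≤ ∑' t, (1 - ENNReal.ofReal κ) ^ t := by
          refine ENNReal.tsum_le_tsum fun t => (hf _).trans ?_
          rw [pow_add, mul_assoc]
          exact mul_le_of_le_one_right' hsmall
      _ = (1 - (1 - ENNReal.ofReal κ))⁻¹ := ENNReal.tsum_geometric _
      _ = ENNReal.ofReal κ⁻¹ := by
          rw [ENNReal.sub_sub_cancel (by simp) (by simpa using h1), ENNReal.ofReal_inv_of_pos h0]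
  rw [← ENNReal.summable.sum_add_tsum_nat_add' (k := T)]
  calc _ ≤ ∑ _t ∈ Finset.range T, (1 : ℝ≥0∞) + ENNReal.ofReal κ⁻¹ := by
        gcongr with t
        exact hf1 t
    _ = ENNReal.ofReal (T + κ⁻¹) := by
        rw [ENNReal.ofReal_add (by positivity) (by positivity)]
        simp
    _ ≤ _ := by
        refine ENNReal.ofReal_le_ofReal ?_
        have h2 : (1 : ℝ) ≤ N / κ := (one_le_div h0).2 (h1.trans hN')
        have h3 : κ⁻¹ ≤ N / κ := by
          rw [div_eq_mul_inv]
          exact le_mul_of_one_le_left (by positivity) hN'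
        have h4 : 5 * N / κ = 3 * N / κ + N / κ + N / κ := by ring
        linarith

/-! ### Independence of the current state and the next slot. -/

section Dynamics

variable {V F : Type} {r : ℕ} [DecidableEq V] [Field F] [DecidableEq F]

theorem messages_congr (x : V → Fin r → F) {ω ω' : ℕ → Slot V (Fin r → F) F} {t : ℕ}
    (h : ∀ i < t, ω i = ω' i) : messages x ω t = messages x ω' t := by
  induction t with
  | zero => rfl
  | succ t ih =>
    rw [messages_succ, messages_succ, ih fun i hi => h i (by omega), h t (by omega)]

variable [Finite V] [Finite F]

theorem measurable_messages [MeasurableSpace (V → Finset (Fin r → F))]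
    [DiscreteMeasurableSpace (V → Finset (Fin r → F))] (x : V → Fin r → F) (t : ℕ) :
    Measurable fun ω : ℕ → Slot V (Fin r → F) F => messages x ω t := by
  induction t with
  | zero => exact measurable_const
  | succ t ih =>
    have h : Measurable fun q : (V → Finset (Fin r → F)) × Slot V (Fin r → F) F =>
      slotStep q.1 q.2 := .of_discrete
    exact h.comp (ih.prodMk (measurable_pi_apply t))

/-- The messages held at time `t` are independent of the slot `t`. -/
theorem indepFun_messages [MeasurableSpace (V → Finset (Fin r → F))]
    [DiscreteMeasurableSpace (V → Finset (Fin r → F))] (x : V → Fin r → F)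
    (ν : Measure (Slot V (Fin r → F) F)) [IsProbabilityMeasure ν] (t : ℕ) :
    ProbabilityTheory.IndepFun (fun ω : ℕ → Slot V (Fin r → F) F => messages x ω t)
      (fun ω => ω t) (Measure.infinitePi fun _ => ν) := by
  have hne : Nonempty (Slot V (Fin r → F) F) := by
    by_contra h
    rw [not_nonempty_iff] at h
    exact IsProbabilityMeasure.ne_zero ν (Measure.eq_zero_of_isEmpty ν)
  obtain ⟨σ₀⟩ := hne
  have hi : ProbabilityTheory.iIndepFun (fun (i : ℕ) (ω : ℕ → Slot V (Fin r → F) F) => ω i)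
      (Measure.infinitePi fun _ => ν) :=
    ProbabilityTheory.iIndepFun_infinitePi (X := fun _ σ => σ) fun _ => measurable_id
  have h := hi.indepFun_finset (Finset.range t) {t} (by simp) fun i => measurable_pi_apply i
  -- Padding a finite prefix with `σ₀` exhibits the state at time `t` as a function of the first `t`
  -- slots alone.
  set ext : (Finset.range t → Slot V (Fin r → F) F) → ℕ → Slot V (Fin r → F) F :=
    fun y i => if hi : i ∈ Finset.range t then y ⟨i, hi⟩ else σ₀ with hext
  have hmext : Measurable ext := measurable_pi_lambda _ fun i => by
    simp only [hext]
    split_ifs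
    · exact measurable_pi_apply _
    · exact measurable_const
  have h' := h.comp ((measurable_messages x t).comp hmext)
    (measurable_pi_apply (⟨t, by simp⟩ : ({t} : Finset ℕ)))
  convert h' using 1
  swap
  · rfl
  funext ω
  refine messages_congr x fun i hi => ?_
  simp [hext, hi]

/-- This stands in for conditioning on the past: independence makes the joint law of state and slot
a product, and Tonelli applies. -/
theorem lintegral_messages_slot (x : V → Fin r → F)
    (ν : Measure (Slot V (Fin r → F) F)) [IsProbabilityMeasure ν] (t : ℕ)
    (f : (V → Finset (Fin r → F)) → Slot V (Fin r → F) F → ℝ≥0∞) :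
    ∫⁻ ω, f (messages x ω t) (ω t) ∂(Measure.infinitePi fun _ : ℕ => ν) =
      ∫⁻ ω, ∫⁻ σ, f (messages x ω t) σ ∂ν ∂(Measure.infinitePi fun _ : ℕ => ν) := by
  let _ : MeasurableSpace (V → Finset (Fin r → F)) := ⊤
  have : DiscreteMeasurableSpace (V → Finset (Fin r → F)) := ⟨fun _ => trivial⟩
  have hm := measurable_messages x t
  have hf : Measurable fun q : (V → Finset (Fin r → F)) × Slot V (Fin r → F) F =>
    f q.1 q.2 := .of_discrete
  have hmap := (indepFun_messages x ν t).map_prod_eq_prod_map_map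
    hm.aemeasurable (measurable_pi_apply t).aemeasurable
  rw [Measure.infinitePi_map_eval (μ := fun _ : ℕ => ν) t] at hmap
  rw [← lintegral_map (f := fun q : (V → Finset (Fin r → F)) × Slot V (Fin r → F) F => f q.1 q.2)
    hf (hm.prodMk (measurable_pi_apply t)), hmap, lintegral_prod _ hf.aemeasurable,
    lintegral_map .of_discrete hm]

theorem measurableSet_messages (x : V → Fin r → F) (t : ℕ)
    (S : Set (V → Finset (Fin r → F))) :
    MeasurableSet {ω : ℕ → Slot V (Fin r → F) F | messages x ω t ∈ S} := by
  let _ : MeasurableSpace (V → Finset (Fin r → F)) := ⊤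
  have : DiscreteMeasurableSpace (V → Finset (Fin r → F)) := ⟨fun _ => trivial⟩
  exact measurable_messages x t (MeasurableSet.of_discrete (s := S))

end Dynamics

/-! ### Bounds on reception probabilities. -/

namespace WirelessNetwork

variable {V : Type}

theorem P_le_one (G : WirelessNetwork V) (u v : V) : G.P u v ≤ 1 := by
  refine ENNReal.toReal_le_of_le_ofReal zero_le_one ?_
  rw [ENNReal.ofReal_one]
  rw [PMF.toOuterMeasure_apply, ← (G.reception u).tsum_coe]
  exact ENNReal.tsum_le_tsum fun R => Set.indicator_le_self _ _ R

/-- An actual link between distinct nodes forces p ≤ 1, which keeps the contraction rate p/(8N) at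
most 1. -/
theorem Connected.exists_link [Fintype V] [Nonempty V] {G : WirelessNetwork V} (hG : G.Connected)
    (hN : 2 ≤ Fintype.card V) : ∃ u v, u ≠ v ∧ 0 < G.P u v := by
  obtain ⟨w⟩ := ‹Nonempty V›
  have hne : G.layer w 0 ≠ Set.univ := fun h => by
    have h1 := congrArg Set.ncard h
    rw [Set.ncard_univ, Nat.card_eq_fintype_card] at h1
    simp [layer] at h1
    omega
  obtain ⟨v, hv, hv0⟩ := Set.exists_of_ssubset (hG.layer_ssubset hne)
  obtain ⟨b, hb, hvb⟩ := hv.resolve_left hv0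
  exact ⟨v, b, fun h => hv0 (h ▸ hb), hvb⟩

end WirelessNetwork

/-! ### Bounds on the mean stopping time. -/

section Latency

variable {V F : Type} {r : ℕ} [DecidableEq V] [Field F] [DecidableEq F]

/-- If some node cannot decode, then the potential is positive. -/
theorem one_le_potential_of_incomplete [Fintype V] (G : WirelessNetwork V)
    {x : V → Fin r → F} (hx : LinearIndependent F x) {ω : ℕ → Slot V (Fin r → F) F} {t : ℕ}
    (h : ¬ ∀ u : V, Module.finrank F (Submodule.span F (messages x ω t u : Set (Fin r → F))) =
      Nat.card V) : 1 ≤ potential G (messages x ω t) := by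
  obtain ⟨w, hw⟩ := not_forall.1 h
  have hspan : spanOn (messages x ω t) (G.layer w 0) =
      Submodule.span F (messages x ω t w : Set (Fin r → F)) := by
    simp [spanOn, WirelessNetwork.layer]
  -- All messages lie in the span of the N packets, so a rank different from N is smaller than N.
  have hle : Module.finrank F (Submodule.span F (messages x ω t w : Set (Fin r → F))) ≤
      Fintype.card V := by
    rw [← finrank_span_eq_card hx]
    exact Submodule.finrank_mono (span_messages_le x ω t w)
  rw [Nat.card_eq_fintype_card] at hw
  have hdef : rankDeficit (messages x ω t) (G.layer w 0) ≠ 0 := by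
    rw [rankDeficit, hspan]
    omega
  have h0 : 1 ≤ layerPotential G (messages x ω t) w 0 := by
    rw [layerPotential, deficitWeight, if_neg hdef, pow_zero, one_mul]
    exact Nat.one_le_two_pow
  have hpos : 0 ∈ Finset.range (Fintype.card V) :=
    Finset.mem_range.2 (Fintype.card_pos_iff.2 ⟨w⟩)
  calc 1 ≤ layerPotential G (messages x ω t) w 0 := h0
    _ ≤ ∑ d ∈ Finset.range (Fintype.card V), layerPotential G (messages x ω t) w d :=
        Finset.single_le_sum (f := layerPotential G (messages x ω t) w)
          (fun _ _ => Nat.zero_le _) hpos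
    _ ≤ _ := Finset.single_le_sum
          (f := fun w => ∑ d ∈ Finset.range (Fintype.card V),
            layerPotential G (messages x ω t) w d)
          (fun _ _ => Nat.zero_le _) (Finset.mem_univ w)

variable [Fintype V] [Nonempty V] [Fintype F]

namespace WirelessNetwork

/-- The mean potential decreases geometrically. -/
theorem lintegral_potential_le {G : WirelessNetwork V} (hG : G.Connected) {p : ℝ}
    (hp : ∀ u v : V, u ≠ v → 0 < G.P u v → p ≤ G.P u v) {x : V → Fin r → F}
    (hx : LinearIndependent F x) (t : ℕ) :
    ∫⁻ ω, (potential G (messages x ω t) : ℝ≥0∞)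
      ∂(Measure.infinitePi fun _ : ℕ => (G.slotLaw (Fin r → F) F).toMeasure) ≤
      (1 - (Fintype.card V : ℝ≥0∞)⁻¹ * (ENNReal.ofReal p * 8⁻¹)) ^ t * 8 ^ Fintype.card V := by
  induction t with
  | zero =>
    rw [pow_zero, one_mul]
    calc _ ≤ ∫⁻ _, (8 : ℝ≥0∞) ^ Fintype.card V
          ∂(Measure.infinitePi fun _ : ℕ => (G.slotLaw (Fin r → F) F).toMeasure) :=
          lintegral_mono fun ω => by
            have := potential_le G (messages x ω 0)
            calc (potential G (messages x ω 0) : ℝ≥0∞) ≤ ((8 ^ Fintype.card V : ℕ) : ℝ≥0∞) :=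
                  Nat.cast_le.2 this
              _ = _ := by simp
      _ = _ := by simp
  | succ t ih =>
    set κ := (Fintype.card V : ℝ≥0∞)⁻¹ * (ENNReal.ofReal p * 8⁻¹) with hκ
    have hκtop : κ ≠ ∞ := by
      rw [hκ]
      exact ENNReal.mul_ne_top (by simp) (ENNReal.mul_ne_top (by simp) (by simp))
    simp only [messages_succ]
    rw [lintegral_messages_slot x _ t fun s σ => (potential G (slotStep s σ) : ℝ≥0∞)]
    calc _ ≤ ∫⁻ ω, (1 - κ) * (potential G (messages x ω t) : ℝ≥0∞)
          ∂(Measure.infinitePi fun _ : ℕ => (G.slotLaw (Fin r → F) F).toMeasure) := by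
          refine lintegral_mono fun ω => ?_
          -- The additive form of the drift becomes a contraction; moving the loss across needs it
          -- to be finite.
          rw [ENNReal.sub_mul fun _ _ => by simp, one_mul]
          exact ENNReal.le_sub_of_add_le_right (ENNReal.mul_ne_top hκtop (by simp))
            (lintegral_potential_slotStep_add_le hG hp hx (packet_mem_messages x ω t))
      _ = (1 - κ) * ∫⁻ ω, (potential G (messages x ω t) : ℝ≥0∞)
          ∂(Measure.infinitePi fun _ : ℕ => (G.slotLaw (Fin r → F) F).toMeasure) :=
          lintegral_const_mul' _ _ (ENNReal.sub_ne_top (by simp))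
      _ ≤ (1 - κ) * ((1 - κ) ^ t * 8 ^ Fintype.card V) := by gcongr
      _ = _ := by rw [← mul_assoc, ← pow_succ']

theorem expectedStoppingTime_le {G : WirelessNetwork V} (hG : G.Connected) {p : ℝ} (hp0 : 0 < p)
    (hp : ∀ u v : V, u ≠ v → 0 < G.P u v → p ≤ G.P u v) {x : V → Fin r → F}
    (hx : LinearIndependent F x) (hN : 2 ≤ Fintype.card V) :
    G.expectedStoppingTime x ≤ ENNReal.ofReal (40 / p * (Fintype.card V : ℝ) ^ 2) := by
  set N := Fintype.card V with hNdef
  set μ := Measure.infinitePi fun _ : ℕ => (G.slotLaw (Fin r → F) F).toMeasure with hμ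
  have hp1 : p ≤ 1 := by
    obtain ⟨u, v, huv, h⟩ := hG.exists_link hN
    exact (hp u v huv h).trans (G.P_le_one u v)
  have hNpos : (0 : ℝ) < N := by exact_mod_cast (by omega : 0 < N)
  have hN1 : (1 : ℝ) ≤ N := by exact_mod_cast (by omega : 1 ≤ N)
  set B : ℕ → Set (ℕ → Slot V (Fin r → F) F) := fun t => {ω | ¬ ∀ u : V,
      Module.finrank F (Submodule.span F (messages x ω t u : Set (Fin r → F))) =
        Nat.card V} with hB
  have hBm : ∀ t, MeasurableSet (B t) := fun t => measurableSet_messages x t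
    {s | ¬ ∀ u : V, Module.finrank F (Submodule.span F (s u : Set (Fin r → F))) = Nat.card V}
  have hκ : (N : ℝ≥0∞)⁻¹ * (ENNReal.ofReal p * 8⁻¹) = ENNReal.ofReal (p / (8 * N)) := by
    rw [div_eq_mul_inv, ENNReal.ofReal_mul hp0.le, mul_inv, ENNReal.ofReal_mul (by norm_num),
      ENNReal.ofReal_inv_of_pos (by norm_num), ENNReal.ofReal_inv_of_pos hNpos,
      ENNReal.ofReal_natCast, ENNReal.ofReal_ofNat]
    ring
  have hBle : ∀ t, μ (B t) ≤ (1 - ENNReal.ofReal (p / (8 * N))) ^ t * 8 ^ N := fun t => by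
    rw [← hκ]
    refine le_trans ?_ (lintegral_potential_le hG hp hx t)
    rw [← lintegral_indicator_one (hBm t)]
    refine lintegral_mono fun ω => ?_
    refine Set.indicator_le (g := fun ω => (potential G (messages x ω t) : ℝ≥0∞))
      (fun ω hω => ?_) ω
    rw [Pi.one_apply, Nat.one_le_cast]
    exact one_le_potential_of_incomplete G hx hω
  have hsum := tsum_le_of_le_one_of_le_geometric (f := fun t => μ (B t)) (κ := p / (8 * N))
    (by positivity) (by rw [div_le_one (by positivity)]; linarith) (N := N) (by omega)
    (fun t => prob_le_one) hBle
  calc G.expectedStoppingTime x ≤ ∫⁻ ω, ∑' t, (B t).indicator 1 ω ∂μ :=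
        lintegral_mono fun ω => stoppingTime_le_tsum x ω
    _ = ∑' t, μ (B t) := by
        rw [lintegral_tsum fun t => (measurable_one.indicator (hBm t)).aemeasurable]
        exact tsum_congr fun t => lintegral_indicator_one (hBm t)
    _ ≤ ENNReal.ofReal (5 * N / (p / (8 * N))) := hsum
    _ = _ := by
        congr 1
        field_simp
        norm_num

theorem card_le_expectedStoppingTime (G : WirelessNetwork V) (x : V → Fin r → F)
    (hN : 2 ≤ Fintype.card V) : (Fintype.card V : ℝ≥0∞) ≤ G.expectedStoppingTime x := by
  calc (Fintype.card V : ℝ≥0∞) = ∫⁻ _, (Fintype.card V : ℝ≥0∞)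
        ∂(Measure.infinitePi fun _ : ℕ => (G.slotLaw (Fin r → F) F).toMeasure) := by simp
    _ ≤ _ := lintegral_mono fun ω => by
        have := card_le_stoppingTime hN x ω
        calc (Fintype.card V : ℝ≥0∞) = ((Fintype.card V : ℕ∞) : ℝ≥0∞) := by simp
          _ ≤ _ := ENat.toENNReal_le.2 this

/-- A single node is complete at time 0. This case stands apart because no link then bounds p by 1.
-/
theorem expectedStoppingTime_eq_zero (G : WirelessNetwork V) {x : V → Fin r → F}
    (hx : LinearIndependent F x) (hN : Fintype.card V < 2) : G.expectedStoppingTime x = 0 := by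
  have h1 : Fintype.card V = 1 := by
    have := Fintype.card_pos (α := V)
    omega
  have h : ∀ ω, stoppingTime x ω = 0 := fun ω => by
    refine le_antisymm (iInf₂_le 0 fun u => ?_) bot_le
    rw [Nat.card_eq_fintype_card, h1]
    have hs : (messages x ω 0 u : Set (Fin r → F)) = {x u} := Finset.coe_singleton _
    rw [hs]
    exact finrank_span_singleton (K := F) (hx.ne_zero u)
  simp [expectedStoppingTime, h]

end WirelessNetwork

end Latency

theorem mainTheorem4 :
    ∃ C : ℝ, 0 < C ∧
      ∀ (V : Type) [Fintype V] [DecidableEq V] [Nonempty V]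
        (F : Type) [Field F] [Fintype F] [DecidableEq F] (q r : ℕ)
        (G : WirelessNetwork V) (x : V → Fin r → F) (p : ℝ),
        Fintype.card F = 2 ^ q →
        LinearIndependent F x →
        0 < p →
        (∀ u v : V, u ≠ v → 0 < G.P u v → p ≤ G.P u v) →
        (∀ ε : ℝ, G.SparselyConnected ε →
          G.expectedStoppingTime x ≤ ENNReal.ofReal (C / p * (Fintype.card V : ℝ) ^ 2)) ∧
        (G.Connected → 2 ≤ Fintype.card V →
          (Fintype.card V : ℝ≥0∞) ≤ G.expectedStoppingTime x ∧
          G.expectedStoppingTime x ≤ ENNReal.ofReal (C / p * (Fintype.card V : ℝ) ^ 2)) := by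
  have key : ∀ (V : Type) [Fintype V] [DecidableEq V] [Nonempty V]
      (F : Type) [Field F] [Fintype F] [DecidableEq F] (r : ℕ)
      (G : WirelessNetwork V) (x : V → Fin r → F) (p : ℝ),
      LinearIndependent F x → 0 < p → (∀ u v : V, u ≠ v → 0 < G.P u v → p ≤ G.P u v) →
      G.Connected →
      G.expectedStoppingTime x ≤ ENNReal.ofReal (40 / p * (Fintype.card V : ℝ) ^ 2) := by
    intro V _ _ _ F _ _ _ r G x p hx hp0 hp hG
    rcases lt_or_ge (Fintype.card V) 2 with hN | hN
    · rw [G.expectedStoppingTime_eq_zero hx hN]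
      exact zero_le
    · exact WirelessNetwork.expectedStoppingTime_le hG hp0 hp hx hN
  -- 40 = 5 · 8: the factor 5 of the tail sum times the 8 in the rate p/(8N).
  refine ⟨40, by norm_num, fun V _ _ _ F _ _ _ q r G x p _ hx hp0 hp => ⟨fun ε hG => ?_,
    fun hG hN => ⟨G.card_le_expectedStoppingTime x hN, ?_⟩⟩⟩
  · exact key V F r G x p hx hp0 hp hG.1
  · exact key V F r G x p hx hp0 hp hG
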